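/- Let $\mathcal P$ be the set of measurable functions $\rho:\mathbb R\to\mathbb R$ that are Lebesgue-a.e. positive and satisfy $\int_{\mathbb R}\rho\,dx=1$ and $\int_{\mathbb R}|x|\rho(x)\,dx<\infty$. For $\rho\in\mathcal P$ let $C[\rho](x)=\int_{-\infty}^x\rho(y)\,dy$ be its cumulative distribution function, $G[\rho]:[0,1]\to[-\infty,+\infty]$ the inverse of $C[\rho]$ (with $G[\rho](0)=-\infty$, $G[\rho](1)=+\infty$), and let $$\mathbf L[\rho](f)=\int_{-\infty}^{G[\rho](f)}y\,\rho(y)\,dy,\qquad f\in[0,1],$$ be its Lorenz curve. Let $\mathfrak L(\mathbb R)=\{\mathbf L[\rho]:\rho\in\mathcal P\}$ be the set of Lorenz curves. For $\hat\rho_0,\hat\rho_1\in\mathcal P$ let $$d_{W_2}^2(\hat\rho_0,\hat\rho_1)=\inf_{\gamma}\int_{\mathbb R\times\mathbb R}|x-y|^2\,d\gamma(x,y)\in[0,\infty],$$ where $\gamma$ ranges over the couplings of $\hat\rho_0(x)\,dx$ and $\hat\rho_1(x)\,dx$, i.e. the measures on $\mathbb R\times\mathbb R$ having these two as first and second marginals.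 Let $k\in\{1,2,\dots\}\cup\{\infty\}$. For $\hat L_0,\hat L_1\in\mathfrak L(\mathbb R)$ let $$d_{\mathfrak L,W_2}^2(\hat L_0,\hat L_1)=\inf_{(\mathcal L_t)}\int_0^1\!\!\int_0^1\bigl(\partial_f\dot{\mathcal L}_t(f)\bigr)^2\,df\,dt\in[0,\infty],$$ where the infimum is over all families $(\mathcal L_t)_{t\in[0,1]}$ in $\mathfrak L(\mathbb R)$ with $\mathcal L_0=\hat L_0$ and $\mathcal L_1=\hat L_1$ such that $t\mapsto\mathcal L_t(f)$ is of class $C^k$ on $[0,1]$ for every $f\in[0,1]$ and, with $\dot{\mathcal L}_t(f)=\partial_t\mathcal L_t(f)$, the function $f\mapsto\dot{\mathcal L}_t(f)$ is differentiable on $(0,1)$ for every $t\in[0,1]$. Then, for every such $k$ and all $\hat\rho_0,\hat\rho_1\in\mathcal P$, $$d_{W_2}^2(\hat\rho_0,\hat\rho_1)=d_{\mathfrak L,W_2}^2\bigl(\mathbf L[\hat\rho_0],\mathbf L[\hat\rho_1]\bigr).$$ -/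

import Mathlib

open MeasureTheory Set

noncomputable section

/-- `ρ` is a positive probability density on `ℝ` with respect to Lebesgue measure, with finite
first moment, so that its Lorenz curve is a real-valued function on `[0,1]`. -/
structure IsPosDensity (ρ : ℝ → ℝ) : Prop where
  measurable : Measurable ρ
  pos : ∀ᵐ x : ℝ, 0 < ρ x
  integrable : Integrable ρ
  integral_eq_one : ∫ x, ρ x = 1
  integrable_moment : Integrable (fun x : ℝ => x * ρ x)

/-- The measure on `ℝ` with Lebesgue density `ρ`. -/
def densityMeasure (ρ : ℝ → ℝ) : Measure ℝ :=
  (volume : Measure ℝ).withDensity (fun x => ENNReal.ofReal (ρ x))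

/-- The set of couplings of `μ` and `ν`. -/
def couplings (μ ν : Measure ℝ) : Set (Measure (ℝ × ℝ)) :=
  {γ | γ.map Prod.fst = μ ∧ γ.map Prod.snd = ν}

/-- The squared 2-Wasserstein distance on the line, with values in `[0,∞]`. -/
def wassersteinSq (μ ν : Measure ℝ) : ENNReal :=
  ⨅ γ ∈ couplings μ ν, ∫⁻ p, ENNReal.ofReal (|p.1 - p.2| ^ 2) ∂γ

/-- The cumulative distribution function `C[ρ]`. -/
def densityCdf (ρ : ℝ → ℝ) (x : ℝ) : ℝ := ∫ y in Iic x, ρ y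

/-- The inverse cdf `G[ρ]`. For a positive density this is the inverse of the cdf on `(0,1)`,
with `G[ρ](0) = -∞` and `G[ρ](1) = +∞`. -/
def densityInvCdf (ρ : ℝ → ℝ) (f : ℝ) : EReal :=
  ⨆ x ∈ {x : ℝ | densityCdf ρ x ≤ f}, (x : EReal)

/-- The Lorenz curve `𝐋[ρ](f) = ∫_{-∞}^{G[ρ](f)} y ρ(y) dy`. -/
def lorenzCurve (ρ : ℝ → ℝ) (f : ℝ) : ℝ :=
  ∫ y in {y : ℝ | (y : EReal) ≤ densityInvCdf ρ f}, y * ρ y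

/-- The set of Lorenz curves over `ℝ`. Only the values on `[0,1]` are constrained: a Lorenz curve
is a function on `[0,1]`, represented by any extension of it to `ℝ`. -/
def lorenzSpace : Set (ℝ → ℝ) :=
  {L | ∃ ρ : ℝ → ℝ, IsPosDensity ρ ∧ EqOn L (lorenzCurve ρ) (Icc 0 1)}

/-- The squared norm `∫₀¹ (η'(f))² df` of a perturbation `η` of a Lorenz curve. -/
def lorenzNormSq (η : ℝ → ℝ) : ENNReal :=
  ∫⁻ f in Icc (0 : ℝ) 1, ENNReal.ofReal (deriv η f ^ 2)

/-- The time derivative at time `t ∈ [0,1]` (one-sided at the end points) of a family `L` of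
functions on `[0,1]`, where `L t f` stands for `𝓛_t(f)`. -/
def timeDeriv (L : ℝ → ℝ → ℝ) (t f : ℝ) : ℝ :=
  derivWithin (fun s => L s f) (Icc 0 1) t

/-- `L` is a curve, of class `C^k` in time, in the space of Lorenz curves from `L₀` to `L₁`:
each `f` sees a `C^k` function of `t ∈ [0,1]`, and the mixed derivative `∂_f ∂_t L` exists on
`[0,1] × (0,1)`. -/
structure IsLorenzPath (k : ℕ∞) (L₀ L₁ : ℝ → ℝ) (L : ℝ → ℝ → ℝ) : Prop where
  mem : ∀ t ∈ Icc (0 : ℝ) 1, L t ∈ lorenzSpace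
  init : EqOn (L 0) L₀ (Icc 0 1)
  final : EqOn (L 1) L₁ (Icc 0 1)
  contDiffOn_time : ∀ f ∈ Icc (0 : ℝ) 1, ContDiffOn ℝ k (fun t => L t f) (Icc 0 1)
  differentiableOn_timeDeriv :
    ∀ t ∈ Icc (0 : ℝ) 1, DifferentiableOn ℝ (timeDeriv L t) (Ioo 0 1)

/-- The squared distance between Lorenz curves: the infimum of the action
`∫₀¹ ‖∂_t L_t‖² dt = ∫₀¹ ∫₀¹ (∂_f ∂_t L_t(f))² df dt` over curves joining them. -/
def lorenzDistSq (k : ℕ∞) (L₀ L₁ : ℝ → ℝ) : ENNReal :=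
  ⨅ (L : ℝ → ℝ → ℝ) (_ : IsLorenzPath k L₀ L₁ L),
    ∫⁻ t in Icc (0 : ℝ) 1, lorenzNormSq (timeDeriv L t)

end

open Filter Topology

noncomputable section

/-! Both sides equal `∫₀¹ (g₁ - g₀)²`, where `g₀`, `g₁` are the quantile functions. On the transport
side, the coupling `f ↦ (g₀ f, g₁ f)` is optimal (`wassersteinSq_eq_lintegral`): the cost integrates
the masses of off-diagonal quadrants, and this coupling minimises each of them.

On the Lorenz side, a Lorenz curve is the primitive of its quantile function
(`IsPosDensity.lorenzCurve_eq`), so the action is that of a flat L² geometry in `g`. Jensen's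
inequality in time bounds every action from below (`lintegral_sq_deriv_le_of_continuous`); the work
there is to exchange `∂_f` with the time integral when the mixed derivative exists only pointwise.
The segment between the two curves attains the bound, and it stays among Lorenz curves because
quantile functions of positive densities form a convex set (`exists_isPosDensity_convexComb`). -/

/-- Lebesgue measure on `(0,1)`. -/
abbrev unitVol : Measure ℝ := (volume : Measure ℝ).restrict (Ioo 0 1)

instance : IsProbabilityMeasure unitVol := ⟨by simp [unitVol]⟩

/-! ### Quantile functions and their inverses -/

/-- `g` restricts to an increasing bijection from `(0,1)` onto `ℝ`. -/
structure IsQuantile (g : ℝ → ℝ) : Prop where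
  strictMonoOn : StrictMonoOn g (Ioo 0 1)
  surjOn : SurjOn g (Ioo 0 1) univ

/-- The inverse of the increasing bijection `g` from `(0,1)` onto `ℝ`. -/
def quantileInv (g : ℝ → ℝ) : ℝ → ℝ := Function.invFunOn g (Ioo 0 1)

namespace IsQuantile

variable {g : ℝ → ℝ}

lemma inv_mem (hg : IsQuantile g) (x : ℝ) : quantileInv g x ∈ Ioo (0 : ℝ) 1 :=
  Function.invFunOn_mem (hg.surjOn (mem_univ x))

lemma apply_inv (hg : IsQuantile g) (x : ℝ) : g (quantileInv g x) = x :=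
  Function.invFunOn_eq (hg.surjOn (mem_univ x))

lemma inv_apply (hg : IsQuantile g) {f : ℝ} (hf : f ∈ Ioo (0 : ℝ) 1) :
    quantileInv g (g f) = f :=
  hg.strictMonoOn.injOn (hg.inv_mem _) hf (hg.apply_inv _)

lemma le_iff (hg : IsQuantile g) {f : ℝ} (hf : f ∈ Ioo (0 : ℝ) 1) (x : ℝ) :
    g f ≤ x ↔ f ≤ quantileInv g x := by
  conv_lhs => rw [← hg.apply_inv x]
  exact hg.strictMonoOn.le_iff_le hf (hg.inv_mem x)

lemma lt_iff (hg : IsQuantile g) {f : ℝ} (hf : f ∈ Ioo (0 : ℝ) 1) (x : ℝ) :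
    x < g f ↔ quantileInv g x < f := by
  simpa using (hg.le_iff hf x).not

lemma strictMono_inv (hg : IsQuantile g) : StrictMono (quantileInv g) := fun x y hxy => by
  rwa [← hg.lt_iff (hg.inv_mem y), hg.apply_inv]

lemma measurable_inv (hg : IsQuantile g) : Measurable (quantileInv g) :=
  hg.strictMono_inv.monotone.measurable

lemma continuousOn (hg : IsQuantile g) : ContinuousOn g (Ioo 0 1) := fun f hf =>
  (hg.strictMonoOn.continuousAt_of_image_mem_nhds (isOpen_Ioo.mem_nhds hf)
    (by rw [hg.surjOn.image_eq_of_mapsTo (mapsTo_univ _ _)]; exact univ_mem)).continuousWithinAt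

lemma aemeasurable (hg : IsQuantile g) : AEMeasurable g unitVol :=
  hg.continuousOn.aemeasurable measurableSet_Ioo

lemma isProbabilityMeasure_map (hg : IsQuantile g) : IsProbabilityMeasure (unitVol.map g) :=
  Measure.isProbabilityMeasure_map hg.aemeasurable

lemma map_apply_Iic (hg : IsQuantile g) (x : ℝ) :
    unitVol.map g (Iic x) = ENNReal.ofReal (quantileInv g x) := by
  rw [Measure.map_apply_of_aemeasurable hg.aemeasurable measurableSet_Iic,
    Measure.restrict_apply' measurableSet_Ioo]
  have : g ⁻¹' Iic x ∩ Ioo 0 1 = Ioc 0 (quantileInv g x) := by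
    ext f
    have := hg.inv_mem x
    constructor
    · rintro ⟨h1, h2⟩
      exact ⟨h2.1, (hg.le_iff h2 x).1 h1⟩
    · rintro ⟨h1, h2⟩
      have hf : f ∈ Ioo (0 : ℝ) 1 := ⟨h1, h2.trans_lt this.2⟩
      exact ⟨(hg.le_iff hf x).2 h2, hf⟩
  rw [this, Real.volume_Ioc, sub_zero]

lemma map_inv_map (hg : IsQuantile g) : (unitVol.map g).map (quantileInv g) = unitVol := by
  rw [AEMeasurable.map_map_of_aemeasurable hg.measurable_inv.aemeasurable hg.aemeasurable]
  conv_rhs => rw [← Measure.map_id (μ := unitVol)]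
  refine Measure.map_congr ?_
  filter_upwards [ae_restrict_mem measurableSet_Ioo] with f hf using hg.inv_apply hf

lemma convexComb {g₀ g₁ : ℝ → ℝ} (h₀ : IsQuantile g₀) (h₁ : IsQuantile g₁) {t : ℝ}
    (ht : t ∈ Icc (0 : ℝ) 1) : IsQuantile (fun f => (1 - t) * g₀ f + t * g₁ f) := by
  obtain ⟨ht0, ht1⟩ := ht
  have hc : ContinuousOn (fun f => (1 - t) * g₀ f + t * g₁ f) (Ioo 0 1) :=
    (continuousOn_const.mul h₀.continuousOn).add (continuousOn_const.mul h₁.continuousOn)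
  refine ⟨fun a ha b hb hab => ?_, fun x _ => ?_⟩
  · have e0 := h₀.strictMonoOn ha hb hab
    have e1 := h₁.strictMonoOn ha hb hab
    rcases ht0.eq_or_lt with rfl | ht0
    · simpa using e0
    · have := mul_lt_mul_of_pos_left e1 ht0
      have := mul_le_mul_of_nonneg_left e0.le (sub_nonneg.2 ht1)
      linarith
  -- At the smaller of the two preimages of `x` both functions are at most `x`, at the larger both
  -- are at least `x`; the intermediate value theorem applies in between.
  · set a := min (quantileInv g₀ x) (quantileInv g₁ x)
    set b := max (quantileInv g₀ x) (quantileInv g₁ x)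
    have m0 := h₀.inv_mem x
    have m1 := h₁.inv_mem x
    have ha : a ∈ Ioo (0 : ℝ) 1 := ⟨lt_min m0.1 m1.1, min_lt_of_left_lt m0.2⟩
    have hb : b ∈ Ioo (0 : ℝ) 1 := ⟨lt_max_of_lt_left m0.1, max_lt m0.2 m1.2⟩
    have hsub : Icc a b ⊆ Ioo 0 1 := Icc_subset_Ioo ha.1 hb.2
    have a0 : g₀ a ≤ x := (h₀.le_iff ha x).2 (min_le_left _ _)
    have a1 : g₁ a ≤ x := (h₁.le_iff ha x).2 (min_le_right _ _)
    have b0 : x ≤ g₀ b := by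
      rw [← h₀.apply_inv x]; exact h₀.strictMonoOn.monotoneOn m0 hb (le_max_left _ _)
    have b1 : x ≤ g₁ b := by
      rw [← h₁.apply_inv x]; exact h₁.strictMonoOn.monotoneOn m1 hb (le_max_right _ _)
    obtain ⟨f, hf, hfx⟩ := intermediate_value_Icc (min_le_max) (hc.mono hsub)
      (show x ∈ _ from ⟨by nlinarith, by nlinarith⟩)
    exact ⟨f, hsub hf, hfx⟩

end IsQuantile

/-! ### The quantile function of a positive density -/

namespace IsPosDensity

variable {ρ : ℝ → ℝ}

lemma isProbabilityMeasure (h : IsPosDensity ρ) : IsProbabilityMeasure (densityMeasure ρ) := by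
  refine ⟨?_⟩
  rw [densityMeasure, withDensity_apply _ MeasurableSet.univ, Measure.restrict_univ,
    ← ofReal_integral_eq_lintegral_ofReal h.integrable (h.pos.mono fun _ hx => hx.le),
    h.integral_eq_one, ENNReal.ofReal_one]

lemma absolutelyContinuous (h : IsPosDensity ρ) : volume ≪ densityMeasure ρ :=
  withDensity_absolutelyContinuous' h.measurable.ennreal_ofReal.aemeasurable
    (h.pos.mono fun x hx => by simpa using hx)

lemma ofReal_densityCdf (h : IsPosDensity ρ) (x : ℝ) :
    ENNReal.ofReal (densityCdf ρ x) = densityMeasure ρ (Iic x) := by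
  rw [densityMeasure, withDensity_apply _ measurableSet_Iic, densityCdf,
    ofReal_integral_eq_lintegral_ofReal h.integrable.integrableOn
      (ae_restrict_of_ae (h.pos.mono fun _ hx => hx.le))]

lemma densityCdf_eq (h : IsPosDensity ρ) (x : ℝ) :
    densityCdf ρ x = (densityMeasure ρ (Iic x)).toReal := by
  rw [← h.ofReal_densityCdf, ENNReal.toReal_ofReal]
  exact setIntegral_nonneg_of_ae (h.pos.mono fun _ hx => hx.le)

lemma densityCdf_eq_cdf (h : IsPosDensity ρ) :
    densityCdf ρ = ProbabilityTheory.cdf (densityMeasure ρ) := by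
  have := h.isProbabilityMeasure
  ext x
  rw [h.densityCdf_eq, ProbabilityTheory.cdf_eq_real]
  rfl

lemma strictMono_densityCdf (h : IsPosDensity ρ) : StrictMono (densityCdf ρ) := fun x y hxy => by
  have : densityCdf ρ y - densityCdf ρ x = ∫ z in x..y, ρ z :=
    intervalIntegral.integral_Iic_sub_Iic h.integrable.integrableOn h.integrable.integrableOn
  rw [← sub_pos, this, intervalIntegral.integral_pos_iff_support_of_nonneg_ae
    (h.pos.mono fun _ hz => hz.le) h.integrable.intervalIntegrable]
  refine ⟨hxy, ?_⟩
  have hs : (Function.support ρ ∩ Ioc x y : Set ℝ) =ᵐ[volume] Ioc x y := by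
    filter_upwards [h.pos] with z hz
    exact propext ⟨fun hz' => hz'.2, fun hz' => ⟨hz.ne', hz'⟩⟩
  rw [measure_congr hs]
  simpa using hxy

lemma continuous_densityCdf (h : IsPosDensity ρ) : Continuous (densityCdf ρ) := by
  have : densityCdf ρ = fun x => densityCdf ρ 0 + ∫ z in (0 : ℝ)..x, ρ z := by
    ext x
    rw [← intervalIntegral.integral_Iic_sub_Iic h.integrable.integrableOn
      h.integrable.integrableOn]
    simp [densityCdf]
  rw [this]
  exact continuous_const.add (h.integrable.continuous_primitive 0)

lemma range_densityCdf (h : IsPosDensity ρ) : range (densityCdf ρ) = Ioo 0 1 := by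
  have := h.isProbabilityMeasure
  have hb : Tendsto (densityCdf ρ) atBot (𝓝 0) := by
    rw [h.densityCdf_eq_cdf]; exact ProbabilityTheory.tendsto_cdf_atBot _
  have ht : Tendsto (densityCdf ρ) atTop (𝓝 1) := by
    rw [h.densityCdf_eq_cdf]; exact ProbabilityTheory.tendsto_cdf_atTop _
  ext f
  constructor
  · rintro ⟨x, rfl⟩
    have hm := h.strictMono_densityCdf
    exact ⟨(hm.monotone.le_of_tendsto hb (x - 1)).trans_lt (hm (by linarith)),
      (hm (show x < x + 1 by linarith)).trans_le (hm.monotone.ge_of_tendsto ht _)⟩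
  · rintro ⟨h0, h1⟩
    exact mem_range_of_exists_le_of_exists_ge h.continuous_densityCdf
      ((hb.eventually (gt_mem_nhds h0)).exists.imp fun _ hx => hx.le)
      ((ht.eventually (lt_mem_nhds h1)).exists.imp fun _ hx => hx.le)

/-- The cdf is continuous and strictly increasing with range `(0,1)`, so its inverse serves; the two
measures agree because they have the same cdf. -/
theorem exists_isQuantile (h : IsPosDensity ρ) :
    ∃ g : ℝ → ℝ, IsQuantile g ∧ unitVol.map g = densityMeasure ρ := by
  have hm := h.strictMono_densityCdf
  have hr := h.range_densityCdf
  set g := Function.invFun (densityCdf ρ)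
  have hgl : ∀ x, g (densityCdf ρ x) = x := Function.leftInverse_invFun hm.injective
  have hgr : ∀ f ∈ Ioo (0 : ℝ) 1, densityCdf ρ (g f) = f := fun f hf =>
    Function.invFun_eq (by rwa [← hr] at hf)
  have hg : IsQuantile g := by
    refine ⟨fun a ha b hb hab => ?_, fun x _ => ⟨densityCdf ρ x, ?_, hgl x⟩⟩
    · rwa [← hm.lt_iff_lt, hgr a ha, hgr b hb]
    · rw [← hr]; exact mem_range_self x
  refine ⟨g, hg, ?_⟩
  have := hg.isProbabilityMeasure_map
  refine Measure.ext_of_Iic _ _ fun x => ?_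
  rw [hg.map_apply_Iic, ← h.ofReal_densityCdf]
  congr 1
  conv_lhs => rw [← hgl x]
  exact hg.inv_apply (by rw [← hr]; exact mem_range_self x)

end IsPosDensity

namespace IsQuantile

variable {g : ℝ → ℝ}

lemma inv_le_iff (hg : IsQuantile g) {f : ℝ} (hf : f ∈ Ioo (0 : ℝ) 1) (x : ℝ) :
    quantileInv g x ≤ f ↔ x ≤ g f := by
  conv_rhs => rw [← hg.apply_inv x]
  exact (hg.strictMonoOn.le_iff_le (hg.inv_mem x) hf).symm

lemma lt_inv_iff (hg : IsQuantile g) {f : ℝ} (hf : f ∈ Ioo (0 : ℝ) 1) (x : ℝ) :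
    f < quantileInv g x ↔ g f < x := by
  simpa using (hg.inv_le_iff hf x).not

lemma map_inv_volume_Ioc (hg : IsQuantile g) {a b : ℝ} (ha : a ∈ Ioo (0 : ℝ) 1)
    (hb : b ∈ Ioo (0 : ℝ) 1) :
    (volume.map (quantileInv g)) (Ioc a b) = ENNReal.ofReal (g b - g a) := by
  rw [Measure.map_apply hg.measurable_inv measurableSet_Ioc, ← Real.volume_Ioc]
  congr 1
  ext x
  exact and_congr (hg.lt_inv_iff ha x) (hg.inv_le_iff hb x)

/-- Among the images of a measure `ν ≪ unitVol`, Lebesgue measure is recognised by the increments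
of `g`. -/
lemma map_eq_volume (hg : IsQuantile g) {ν : Measure ℝ} (hν : ν ≪ unitVol)
    (h : ∀ a ∈ Ioo (0 : ℝ) 1, ∀ b ∈ Ioo (0 : ℝ) 1, ν (Ioc a b) = ENNReal.ofReal (g b - g a)) :
    ν.map g = volume := by
  refine (Measure.ext_of_Ioc _ _ fun x y _ => ?_).symm
  rw [Measure.map_apply_of_aemeasurable (hg.aemeasurable.mono_ac hν) measurableSet_Ioc,
    Real.volume_Ioc]
  have : (g ⁻¹' Ioc x y : Set ℝ) =ᵐ[ν] Ioc (quantileInv g x) (quantileInv g y) := by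
    filter_upwards [hν.ae_le (ae_restrict_mem measurableSet_Ioo)] with f hf
    exact propext (and_congr (hg.lt_iff hf x) (hg.le_iff hf y))
  rw [measure_congr this, h _ (hg.inv_mem x) _ (hg.inv_mem y), hg.apply_inv, hg.apply_inv]

end IsQuantile

/-! ### Lorenz curves as primitives, and null sets -/

namespace IsPosDensity

variable {ρ g : ℝ → ℝ}

lemma integrable_densityMeasure_iff (h : IsPosDensity ρ) {u : ℝ → ℝ} :
    Integrable u (densityMeasure ρ) ↔ Integrable (fun x => u x * ρ x) := by
  rw [densityMeasure, integrable_withDensity_iff h.measurable.ennreal_ofReal (by simp)]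
  refine integrable_congr ?_
  filter_upwards [h.pos] with x hx
  rw [ENNReal.toReal_ofReal hx.le]

lemma setIntegral_densityMeasure (h : IsPosDensity ρ) (u : ℝ → ℝ) {s : Set ℝ}
    (hs : MeasurableSet s) : ∫ x in s, u x ∂(densityMeasure ρ) = ∫ x in s, u x * ρ x := by
  rw [densityMeasure, setIntegral_withDensity_eq_setIntegral_toReal_smul
    h.measurable.ennreal_ofReal (by simp) _ hs]
  refine integral_congr_ae (ae_restrict_of_ae ?_)
  filter_upwards [h.pos] with x hx
  rw [ENNReal.toReal_ofReal hx.le, smul_eq_mul, mul_comm]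

lemma integrable_quantile (h : IsPosDensity ρ) (hg : IsQuantile g)
    (hm : unitVol.map g = densityMeasure ρ) : Integrable g unitVol := by
  have : Integrable (fun x : ℝ => x) (densityMeasure ρ) :=
    h.integrable_densityMeasure_iff.2 h.integrable_moment
  rw [← hm] at this
  exact this.comp_aemeasurable hg.aemeasurable

lemma densityCdf_eq_quantileInv (h : IsPosDensity ρ) (hg : IsQuantile g)
    (hm : unitVol.map g = densityMeasure ρ) (x : ℝ) : densityCdf ρ x = quantileInv g x := by
  rw [h.densityCdf_eq, ← hm, hg.map_apply_Iic, ENNReal.toReal_ofReal (hg.inv_mem x).1.le]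

lemma densityInvCdf_eq (h : IsPosDensity ρ) (hg : IsQuantile g)
    (hm : unitVol.map g = densityMeasure ρ) {f : ℝ} (hf : f ∈ Ioo (0 : ℝ) 1) :
    densityInvCdf ρ f = (g f : EReal) := by
  rw [densityInvCdf]
  simp only [mem_ofPred_eq, h.densityCdf_eq_quantileInv hg hm, hg.inv_le_iff hf]
  exact le_antisymm (iSup₂_le fun x hx => EReal.coe_le_coe_iff.2 hx)
    (le_iSup₂_of_le (g f) le_rfl le_rfl)

lemma densityInvCdf_zero (h : IsPosDensity ρ) : densityInvCdf ρ 0 = ⊥ := by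
  have : ∀ x, 0 < densityCdf ρ x := fun x =>
    (h.range_densityCdf ▸ mem_range_self x : densityCdf ρ x ∈ Ioo (0 : ℝ) 1).1
  simp [densityInvCdf, (this _).not_ge]

lemma densityInvCdf_one (h : IsPosDensity ρ) : densityInvCdf ρ 1 = ⊤ := by
  have : ∀ x, densityCdf ρ x ≤ 1 := fun x =>
    (h.range_densityCdf ▸ mem_range_self x : densityCdf ρ x ∈ Ioo (0 : ℝ) 1).2.le
  simp only [densityInvCdf, mem_ofPred_eq, this, iSup_pos]
  refine EReal.eq_top_iff_forall_lt _ |>.2 fun y => ?_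
  exact (EReal.coe_lt_coe_iff.2 (lt_add_one y)).trans_le (le_iSup (fun x : ℝ => (x : EReal)) _)

/-- The Lorenz curve is the primitive of the quantile function. -/
theorem lorenzCurve_eq (h : IsPosDensity ρ) (hg : IsQuantile g)
    (hm : unitVol.map g = densityMeasure ρ) {f : ℝ} (hf : f ∈ Icc (0 : ℝ) 1) :
    lorenzCurve ρ f = ∫ y in (0 : ℝ)..f, g y := by
  rw [intervalIntegral.integral_of_le hf.1, lorenzCurve]
  rcases hf.1.eq_or_lt with rfl | h0
  · simp [h.densityInvCdf_zero]
  -- The change of variables `y = g f`, stated for a general set so as to cover both the half-line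
  -- and, at `f = 1`, the whole line.
  have key : ∀ s : Set ℝ, MeasurableSet s → (g ⁻¹' s ∩ Ioo 0 1 : Set ℝ) =ᵐ[volume] Ioc 0 f →
      ∫ y in s, y * ρ y = ∫ y in Ioc 0 f, g y := fun s hs hsf => by
    rw [← h.setIntegral_densityMeasure (fun y => y) hs, ← hm,
      setIntegral_map (f := fun y => y) hs aestronglyMeasurable_id hg.aemeasurable,
      Measure.restrict_restrict₀' measurableSet_Ioo.nullMeasurableSet]
    exact setIntegral_congr_set hsf
  rcases hf.2.eq_or_lt with rfl | h1
  · simp only [h.densityInvCdf_one, le_top, ofPred_true]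
    refine key _ MeasurableSet.univ ?_
    simpa using Ioo_ae_eq_Ioc
  · simp only [h.densityInvCdf_eq hg hm ⟨h0, h1⟩, EReal.coe_le_coe_iff]
    refine key _ measurableSet_Iic ?_
    refine EventuallyEq.of_eq ?_
    ext y
    constructor
    · rintro ⟨e1, e2⟩
      exact ⟨e2.1, (hg.strictMonoOn.le_iff_le e2 ⟨h0, h1⟩).1 e1⟩
    · rintro ⟨e1, e2⟩
      have hy : y ∈ Ioo (0 : ℝ) 1 := ⟨e1, e2.trans_lt h1⟩
      exact ⟨(hg.strictMonoOn.le_iff_le hy ⟨h0, h1⟩).2 e2, hy⟩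

lemma map_inv_volume_absolutelyContinuous (h : IsPosDensity ρ) (hg : IsQuantile g)
    (hm : unitVol.map g = densityMeasure ρ) : volume.map (quantileInv g) ≪ unitVol := by
  conv_rhs => rw [← hg.map_inv_map, hm]
  exact h.absolutelyContinuous.map hg.measurable_inv

lemma absolutelyContinuous_map_inv_volume (hg : IsQuantile g)
    (hm : unitVol.map g = densityMeasure ρ) : unitVol ≪ volume.map (quantileInv g) := by
  conv_lhs => rw [← hg.map_inv_map, hm]
  exact (withDensity_absolutelyContinuous _ _).map hg.measurable_inv

/-- A probability measure with finite first moment that has the same null sets as Lebesgue measure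
has a positive density. -/
lemma exists_of_absolutelyContinuous {μ : Measure ℝ} [IsProbabilityMeasure μ]
    (h₁ : μ ≪ volume) (h₂ : volume ≪ μ) (hi : Integrable (fun x : ℝ => x) μ) :
    ∃ ρ : ℝ → ℝ, IsPosDensity ρ ∧ densityMeasure ρ = μ := by
  set ρ : ℝ → ℝ := fun x => (μ.rnDeriv volume x).toReal
  have hpos : ∀ᵐ x : ℝ, 0 < ρ x := by
    filter_upwards [h₂.ae_le (Measure.rnDeriv_pos h₁), Measure.rnDeriv_lt_top μ volume] with x hx hx'
    exact ENNReal.toReal_pos hx.ne' hx'.ne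
  have hρ : densityMeasure ρ = μ := by
    conv_rhs => rw [← Measure.withDensity_rnDeriv_eq μ volume h₁]
    refine withDensity_congr_ae ?_
    filter_upwards [Measure.rnDeriv_lt_top μ volume] with x hx
    exact ENNReal.ofReal_toReal hx.ne
  have hmeas : Measurable ρ := (Measure.measurable_rnDeriv _ _).ennreal_toReal
  refine ⟨ρ, ⟨hmeas, hpos, Measure.integrable_toReal_rnDeriv, ?_, ?_⟩, hρ⟩
  · rw [Measure.integral_toReal_rnDeriv h₁]; simp
  · have hi' := hi
    rw [← hρ, densityMeasure, integrable_withDensity_iff hmeas.ennreal_ofReal (by simp)] at hi'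
    refine hi'.congr ?_
    filter_upwards [hpos] with x hx
    rw [ENNReal.toReal_ofReal hx.le]

end IsPosDensity

/-! ### Convexity of the set of Lorenz curves -/

/-- The displacement interpolation of two positive densities has a positive density. -/
theorem exists_isPosDensity_convexComb {ρ₀ ρ₁ g₀ g₁ : ℝ → ℝ} (h₀ : IsPosDensity ρ₀)
    (h₁ : IsPosDensity ρ₁) (hg₀ : IsQuantile g₀) (hg₁ : IsQuantile g₁)
    (hm₀ : unitVol.map g₀ = densityMeasure ρ₀) (hm₁ : unitVol.map g₁ = densityMeasure ρ₁)
    {t : ℝ} (ht : t ∈ Icc (0 : ℝ) 1) :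
    ∃ ρ, IsPosDensity ρ ∧
      unitVol.map (fun f => (1 - t) * g₀ f + t * g₁ f) = densityMeasure ρ := by
  set g := fun f => (1 - t) * g₀ f + t * g₁ f
  have hg : IsQuantile g := hg₀.convexComb hg₁ ht
  -- `ν` is the Stieltjes measure `dg`, which is linear in `g`. It has the null sets of Lebesgue
  -- measure on `(0,1)` since both summands do, and `g` pushes it to Lebesgue measure on `ℝ`. Hence
  -- the image of `unitVol` under `g` is equivalent to Lebesgue measure.
  set ν : Measure ℝ := ENNReal.ofReal (1 - t) • volume.map (quantileInv g₀) +
    ENNReal.ofReal t • volume.map (quantileInv g₁)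
  have hν : ν ≪ unitVol := Measure.AbsolutelyContinuous.add_left
    ((h₀.map_inv_volume_absolutelyContinuous hg₀ hm₀).smul_left _)
    ((h₁.map_inv_volume_absolutelyContinuous hg₁ hm₁).smul_left _)
  have hν' : unitVol ≪ ν := by
    rcases ht.1.eq_or_lt with rfl | h0
    · simpa [ν] using IsPosDensity.absolutelyContinuous_map_inv_volume hg₀ hm₀
    · refine (IsPosDensity.absolutelyContinuous_map_inv_volume hg₁ hm₁).trans ?_
      refine (Measure.absolutelyContinuous_smul (ENNReal.ofReal_pos.2 h0).ne').trans ?_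
      exact Measure.AbsolutelyContinuous.rfl.add_right' _
  have hmap : ν.map g = volume := by
    refine hg.map_eq_volume hν fun a ha b hb => ?_
    rw [Measure.add_apply, Measure.smul_apply, Measure.smul_apply, smul_eq_mul, smul_eq_mul,
      hg₀.map_inv_volume_Ioc ha hb, hg₁.map_inv_volume_Ioc ha hb]
    rcases le_total a b with hab | hab
    · have e0 := hg₀.strictMonoOn.monotoneOn ha hb hab
      have e1 := hg₁.strictMonoOn.monotoneOn ha hb hab
      rw [← ENNReal.ofReal_mul (by linarith [ht.2]), ← ENNReal.ofReal_mul ht.1,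
        ← ENNReal.ofReal_add (mul_nonneg (by linarith [ht.2]) (by linarith))
          (mul_nonneg ht.1 (by linarith))]
      congr 1
      simp only [g]
      ring
    · have e0 := hg₀.strictMonoOn.monotoneOn hb ha hab
      have e1 := hg₁.strictMonoOn.monotoneOn hb ha hab
      have e := hg.strictMonoOn.monotoneOn hb ha hab
      simp [ENNReal.ofReal_of_nonpos (sub_nonpos.2 e0), ENNReal.ofReal_of_nonpos (sub_nonpos.2 e1),
        ENNReal.ofReal_of_nonpos (sub_nonpos.2 e)]
  have := hg.isProbabilityMeasure_map
  have hi : Integrable g unitVol :=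
    ((h₀.integrable_quantile hg₀ hm₀).const_mul _).add
      ((h₁.integrable_quantile hg₁ hm₁).const_mul _)
  have ac : ∀ μ ν : Measure ℝ, ν ≪ unitVol → μ ≪ unitVol → μ ≪ ν → μ.map g ≪ ν.map g :=
    fun μ ν hν hμ hμν => by
      refine Measure.AbsolutelyContinuous.mk fun s hs h => ?_
      rw [Measure.map_apply_of_aemeasurable (hg.aemeasurable.mono_ac hν) hs] at h
      rw [Measure.map_apply_of_aemeasurable (hg.aemeasurable.mono_ac hμ) hs]
      exact hμν h
  obtain ⟨ρ, hρ, e⟩ := IsPosDensity.exists_of_absolutelyContinuous (μ := unitVol.map g)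
    (hmap ▸ ac _ _ hν .rfl hν') (by conv_lhs => rw [← hmap]
                                    exact ac _ _ .rfl hν hν)
    ((integrable_map_measure aestronglyMeasurable_id hg.aemeasurable).2 hi)
  exact ⟨ρ, hρ, e.symm⟩

/-! ### Optimality of the comonotone coupling -/

/-- The open triangle of pairs `s < t` in the interval from `p.1` to `p.2`, with its left leg. -/
def triangle (p : ℝ × ℝ) : Set (ℝ × ℝ) := {q | p.1 ≤ q.1 ∧ q.1 < q.2 ∧ q.2 < p.2}

lemma volume_triangle (p : ℝ × ℝ) :
    volume (triangle p) = ENNReal.ofReal ((max (p.2 - p.1) 0) ^ 2 / 2) := by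
  have : triangle p = regionBetween id (fun _ => p.2) (Icc p.1 p.2) := by
    ext q
    simp only [triangle, regionBetween, id, mem_ofPred_eq, mem_Icc, mem_Ioo]
    constructor
    · rintro ⟨h1, h2, h3⟩
      exact ⟨⟨h1, (h2.trans h3).le⟩, h2, h3⟩
    · rintro ⟨⟨h1, _⟩, h2, h3⟩
      exact ⟨h1, h2, h3⟩
  rw [this, Measure.volume_eq_prod, volume_regionBetween_eq_integral
    continuous_id.continuousOn.integrableOn_Icc continuousOn_const.integrableOn_Icc
    measurableSet_Icc (fun s hs => hs.2)]
  congr 1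
  rcases le_total p.1 p.2 with h | h
  · simp only [Pi.sub_apply, id]
    rw [integral_Icc_eq_integral_Ioc, ← intervalIntegral.integral_of_le h,
      intervalIntegral.integral_sub (by simp) (by simp), max_eq_left (by linarith)]
    simp
    ring
  · rw [max_eq_right (by linarith)]
    have : volume.restrict (Icc p.1 p.2) = 0 := by
      rw [Measure.restrict_eq_zero]; simp [h]
    simp [this]

lemma measurableSet_triangle :
    MeasurableSet {z : (ℝ × ℝ) × (ℝ × ℝ) | z.2 ∈ triangle z.1} := by
  simp only [triangle, mem_ofPred_eq]
  measurability

/-- One triangle is empty and the other is half a square. Tonelli then turns the cost into an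
integral of quadrant masses. -/
lemma ofReal_abs_sub_sq (p : ℝ × ℝ) : ENNReal.ofReal (|p.1 - p.2| ^ 2) =
    2 * (volume (triangle p) + volume (triangle p.swap)) := by
  rw [volume_triangle, volume_triangle, ← ENNReal.ofReal_add (by positivity) (by positivity),
    ← ENNReal.ofReal_ofNat 2, ← ENNReal.ofReal_mul (by norm_num)]
  congr 1
  simp only [Prod.fst_swap, Prod.snd_swap, sq_abs]
  rcases le_total p.1 p.2 with h | h
  · rw [max_eq_left (by linarith), max_eq_right (by linarith)]; ring
  · rw [max_eq_right (by linarith), max_eq_left (by linarith)]; ring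

lemma lintegral_volume_triangle (γ : Measure (ℝ × ℝ)) [SFinite γ] :
    ∫⁻ p, volume (triangle p) ∂γ = ∫⁻ q, γ {p | q ∈ triangle p} := by
  have h := Measure.prod_apply (μ := γ) (ν := (volume : Measure (ℝ × ℝ))) measurableSet_triangle
  rw [Measure.prod_apply_symm measurableSet_triangle] at h
  exact h.symm

/-- The quadratic cost of a measure in terms of the mass it gives to quadrants. -/
lemma lintegral_ofReal_abs_sub_sq (γ : Measure (ℝ × ℝ)) [SFinite γ] :
    ∫⁻ p, ENNReal.ofReal (|p.1 - p.2| ^ 2) ∂γ = 2 * ((∫⁻ q, γ {p | q ∈ triangle p}) +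
      ∫⁻ q, (γ.map Prod.swap) {p | q ∈ triangle p}) := by
  have hm : Measurable fun p => volume (triangle p) :=
    measurable_measure_prodMk_left measurableSet_triangle
  simp_rw [ofReal_abs_sub_sq]
  rw [lintegral_const_mul' _ _ ENNReal.ofNat_ne_top, lintegral_add_left hm,
    ← lintegral_volume_triangle, ← lintegral_volume_triangle, lintegral_map hm measurable_swap]

section Comonotone

variable {μ₀ μ₁ : Measure ℝ} {g₀ g₁ : ℝ → ℝ}

lemma IsQuantile.aemeasurable_prodMk (hg₀ : IsQuantile g₀) (hg₁ : IsQuantile g₁) :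
    AEMeasurable (fun f => (g₀ f, g₁ f)) unitVol := hg₀.aemeasurable.prodMk hg₁.aemeasurable

lemma comonotone_mem_couplings (hg₀ : IsQuantile g₀) (hg₁ : IsQuantile g₁)
    (hm₀ : unitVol.map g₀ = μ₀) (hm₁ : unitVol.map g₁ = μ₁) :
    unitVol.map (fun f => (g₀ f, g₁ f)) ∈ couplings μ₀ μ₁ := by
  have h := hg₀.aemeasurable_prodMk hg₁
  refine ⟨?_, ?_⟩
  · rw [AEMeasurable.map_map_of_aemeasurable measurable_fst.aemeasurable h, ← hm₀]; rfl
  · rw [AEMeasurable.map_map_of_aemeasurable measurable_snd.aemeasurable h, ← hm₁]; rfl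

/-- The comonotone coupling gives the least mass to quadrants off the diagonal. -/
lemma comonotone_triangle_le (hg₀ : IsQuantile g₀) (hg₁ : IsQuantile g₁)
    (hm₀ : unitVol.map g₀ = μ₀) (hm₁ : unitVol.map g₁ = μ₁) {γ : Measure (ℝ × ℝ)}
    (hγ : γ ∈ couplings μ₀ μ₁) (q : ℝ × ℝ) :
    (unitVol.map fun f => (g₀ f, g₁ f)) {p | q ∈ triangle p} ≤ γ {p | q ∈ triangle p} := by
  obtain ⟨s, t⟩ := q
  by_cases hst : s < t
  swap
  · simp [triangle, hst]
  have hset : {p : ℝ × ℝ | (s, t) ∈ triangle p} = Iic s ×ˢ Ioi t := by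
    ext p; simp [triangle, hst]
  have hc : (unitVol.map fun f => (g₀ f, g₁ f)) (Iic s ×ˢ Ioi t) ≤
      ENNReal.ofReal (quantileInv g₀ s - quantileInv g₁ t) := by
    rw [Measure.map_apply_of_aemeasurable (hg₀.aemeasurable_prodMk hg₁)
      (measurableSet_Iic.prod measurableSet_Ioi), Measure.restrict_apply' measurableSet_Ioo,
      ← Real.volume_Ioc]
    refine measure_mono ?_
    rintro f ⟨⟨h1, h2⟩, hf⟩
    exact ⟨(hg₁.lt_iff hf t).1 h2, (hg₀.le_iff hf s).1 h1⟩
  rw [hset]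
  refine hc.trans ?_
  -- The Fréchet bound: every coupling gives the quadrant at least the difference of the marginal
  -- cdfs, as `{p.1 ≤ s}` lies in the union of the quadrant and `{p.2 ≤ t}`.
  rw [ENNReal.ofReal_sub _ (hg₁.inv_mem t).1.le, ← hg₀.map_apply_Iic, ← hg₁.map_apply_Iic, hm₀,
    hm₁, ← hγ.1, ← hγ.2, Measure.map_apply measurable_fst measurableSet_Iic,
    Measure.map_apply measurable_snd measurableSet_Iic, tsub_le_iff_right]
  refine (measure_mono fun p hp => ?_).trans (measure_union_le _ _)
  by_cases h : p.2 ≤ t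
  · exact Or.inr h
  · exact Or.inl ⟨hp, not_le.1 h⟩

/-- The comonotone coupling is optimal for the quadratic cost. -/
theorem wassersteinSq_eq_lintegral (hg₀ : IsQuantile g₀) (hg₁ : IsQuantile g₁)
    (hm₀ : unitVol.map g₀ = μ₀) (hm₁ : unitVol.map g₁ = μ₁) :
    wassersteinSq μ₀ μ₁ = ∫⁻ f, ENNReal.ofReal ((g₁ f - g₀ f) ^ 2) ∂unitVol := by
  have hpr := hg₀.aemeasurable_prodMk hg₁
  have hmem := comonotone_mem_couplings hg₀ hg₁ hm₀ hm₁
  have : ∫⁻ f, ENNReal.ofReal ((g₁ f - g₀ f) ^ 2) ∂unitVol =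
      ∫⁻ p, ENNReal.ofReal (|p.1 - p.2| ^ 2) ∂(unitVol.map fun f => (g₀ f, g₁ f)) := by
    rw [lintegral_map' (by fun_prop) hpr]
    refine lintegral_congr fun f => ?_
    rw [sq_abs, sub_sq_comm]
  rw [this]
  refine le_antisymm (iInf₂_le _ hmem) (le_iInf₂ fun γ hγ => ?_)
  have : IsProbabilityMeasure γ := by
    refine ⟨?_⟩
    have h := hg₀.isProbabilityMeasure_map.measure_univ
    rwa [hm₀, ← hγ.1, Measure.map_apply measurable_fst MeasurableSet.univ] at h
  have hγ' : γ.map Prod.swap ∈ couplings μ₁ μ₀ := by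
    refine ⟨?_, ?_⟩
    · rw [Measure.map_map measurable_fst measurable_swap, ← hγ.2]; rfl
    · rw [Measure.map_map measurable_snd measurable_swap, ← hγ.1]; rfl
  have hsw : (unitVol.map fun f => (g₀ f, g₁ f)).map Prod.swap =
      unitVol.map fun f => (g₁ f, g₀ f) := by
    rw [AEMeasurable.map_map_of_aemeasurable measurable_swap.aemeasurable hpr]; rfl
  rw [lintegral_ofReal_abs_sub_sq, lintegral_ofReal_abs_sub_sq, hsw]
  exact mul_le_mul_right (add_le_add
    (lintegral_mono (comonotone_triangle_le hg₀ hg₁ hm₀ hm₁ hγ))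
    (lintegral_mono (comonotone_triangle_le hg₁ hg₀ hm₁ hm₀ hγ'))) _

end Comonotone

/-! ### Lower bound for the action -/

lemma ofReal_sq_integral_le {α : Type*} [MeasurableSpace α] {μ : Measure α}
    [IsProbabilityMeasure μ] {u : α → ℝ} (hu : AEStronglyMeasurable u μ) :
    ENNReal.ofReal ((∫ x, u x ∂μ) ^ 2) ≤ ∫⁻ x, ENNReal.ofReal (u x ^ 2) ∂μ := by
  by_cases h : ∫⁻ x, ENNReal.ofReal (u x ^ 2) ∂μ = ⊤
  · simp [h]
  have hsq : Integrable (fun x => u x ^ 2) μ := ⟨hu.pow 2, by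
    rw [hasFiniteIntegral_iff_ofReal (ae_of_all _ fun x => sq_nonneg _)]
    exact lt_top_iff_ne_top.2 h⟩
  have hL : MemLp u 2 μ := (memLp_two_iff_integrable_sq hu).2 hsq
  rw [← ofReal_integral_eq_lintegral_ofReal hsq (ae_of_all _ fun x => sq_nonneg _)]
  refine ENNReal.ofReal_le_ofReal ?_
  have := ProbabilityTheory.variance_nonneg u μ
  rw [ProbabilityTheory.variance_eq_sub hL] at this
  simpa using this

section Action

variable {D : ℝ → ℝ → ℝ}

lemma measurable_uncurry_indicator (hc : ∀ f ∈ Ioo (0 : ℝ) 1, Continuous fun t => D t f)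
    (hd : ∀ t, DifferentiableOn ℝ (D t) (Ioo 0 1)) :
    Measurable (Function.uncurry fun t => (Ioo (0 : ℝ) 1).indicator (D t)) := by
  refine (stronglyMeasurable_uncurry_of_continuous_of_stronglyMeasurable (fun f => ?_)
    fun t => ?_).measurable
  · by_cases hf : f ∈ Ioo (0 : ℝ) 1
    · simpa [indicator_of_mem hf] using hc f hf
    · simpa [indicator_of_notMem hf] using continuous_const
  · refine Measurable.stronglyMeasurable ?_
    have := (hd t).continuousOn.measurable_piecewise (g := fun _ => 0) continuousOn_const
      measurableSet_Ioo
    exact piecewise_eq_indicator (s := Ioo (0 : ℝ) 1) (f := D t) ▸ this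

/-- The derivative is a limit of difference quotients of jointly measurable functions. A shifted
point may leave `(0,1)`, where `E` vanishes, but not in the limit. -/
lemma measurable_uncurry_indicator_deriv (hc : ∀ f ∈ Ioo (0 : ℝ) 1, Continuous fun t => D t f)
    (hd : ∀ t, DifferentiableOn ℝ (D t) (Ioo 0 1)) :
    Measurable (Function.uncurry fun t => (Ioo (0 : ℝ) 1).indicator (deriv (D t))) := by
  have hm := measurable_uncurry_indicator hc hd
  set E : ℝ → ℝ → ℝ := fun t => (Ioo (0 : ℝ) 1).indicator (D t)
  let ε : ℕ → ℝ := fun n => 1 / ((n : ℝ) + 1)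
  have hε : Tendsto ε atTop (𝓝[≠] 0) := tendsto_nhdsWithin_iff.2
    ⟨tendsto_one_div_add_atTop_nhds_zero_nat, Eventually.of_forall fun n => by
      simp only [ε, mem_compl_iff, mem_singleton_iff]; positivity⟩
  refine measurable_of_tendsto_metrizable (f := fun n => (Prod.snd ⁻¹' Ioo (0 : ℝ) 1).indicator
    fun z : ℝ × ℝ => (ε n)⁻¹ * (E z.1 (z.2 + ε n) - E z.1 z.2)) (fun n => ?_) ?_
  · refine Measurable.indicator (Measurable.const_mul (Measurable.sub ?_ hm) _)
      (measurable_snd measurableSet_Ioo)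
    exact hm.comp (f := fun z : ℝ × ℝ => (z.1, z.2 + ε n)) (by fun_prop)
  · refine tendsto_pi_nhds.2 fun z => ?_
    obtain ⟨t, f⟩ := z
    by_cases hf : f ∈ Ioo (0 : ℝ) 1
    · simp only [Function.uncurry, indicator_of_mem hf,
        indicator_of_mem (s := Prod.snd ⁻¹' Ioo (0 : ℝ) 1) (a := (t, f)) hf]
      have h1 : HasDerivAt (E t) (deriv (D t) f) f := by
        refine ((hd t).differentiableAt (isOpen_Ioo.mem_nhds hf)).hasDerivAt.congr_of_eventuallyEq ?_
        filter_upwards [isOpen_Ioo.mem_nhds hf] with y hy using indicator_of_mem hy _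
      exact h1.tendsto_slope_zero.comp hε
    · simp only [Function.uncurry, indicator_of_notMem hf,
        indicator_of_notMem (s := Prod.snd ⁻¹' Ioo (0 : ℝ) 1) (a := (t, f)) hf]
      exact tendsto_const_nhds

/-- If `M = ∫₀¹ D t dt` on `(0,1)`, then the energy of `M` is at most the action of `D`. -/
theorem lintegral_sq_deriv_le_of_continuous {M m : ℝ → ℝ}
    (hc : ∀ f ∈ Ioo (0 : ℝ) 1, Continuous fun t => D t f)
    (hd : ∀ t, DifferentiableOn ℝ (D t) (Ioo 0 1))
    (hM : ∀ f ∈ Ioo (0 : ℝ) 1, HasDerivAt M (m f) f)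
    (hint : ∀ f ∈ Ioo (0 : ℝ) 1, M f = ∫ t, D t f ∂unitVol) :
    ∫⁻ f, ENNReal.ofReal (m f ^ 2) ∂unitVol ≤
      ∫⁻ t, ∫⁻ f, ENNReal.ofReal (deriv (D t) f ^ 2) ∂unitVol ∂unitVol := by
  have hHm := measurable_uncurry_indicator_deriv hc hd
  set H : ℝ → ℝ → ℝ := fun t => (Ioo (0 : ℝ) 1).indicator (deriv (D t)) with hH
  have hA : ∫⁻ t, ∫⁻ f, ENNReal.ofReal (deriv (D t) f ^ 2) ∂unitVol ∂unitVol =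
      ∫⁻ t, ∫⁻ f, ENNReal.ofReal (H t f ^ 2) ∂unitVol ∂unitVol := by
    refine lintegral_congr fun t => setLIntegral_congr_fun measurableSet_Ioo fun f hf => ?_
    simp only [hH, indicator_of_mem hf]
  rw [hA]
  by_cases htop : ∫⁻ t, ∫⁻ f, ENNReal.ofReal (H t f ^ 2) ∂unitVol ∂unitVol = ⊤
  · simp [htop]
  have hHsq : Measurable (Function.uncurry fun t f => ENNReal.ofReal (H t f ^ 2)) :=
    (hHm.pow_const 2).ennreal_ofReal
  -- Finite action puts the mixed derivative in L², hence in L¹ of the unit square, which is what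
  -- Fubini needs.
  have hHi : Integrable (Function.uncurry H) (unitVol.prod unitVol) := by
    refine MemLp.integrable one_le_two ((memLp_two_iff_integrable_sq hHm.aestronglyMeasurable).2
      ⟨(hHm.pow_const 2).aestronglyMeasurable, ?_⟩)
    rw [hasFiniteIntegral_iff_ofReal (ae_of_all _ fun x => sq_nonneg _)]
    refine lt_of_eq_of_lt (lintegral_prod _ hHsq.aemeasurable) (lt_top_iff_ne_top.2 htop)
  set K : ℝ → ℝ := fun f => ∫ t, H t f ∂unitVol
  have hKi : Integrable K := by
    have : Integrable K unitVol := hHi.integral_prod_right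
    refine (integrableOn_iff_integrable_of_support_subset (s := Ioo (0 : ℝ) 1) ?_).1 this
    refine Function.support_subset_iff'.2 fun f hf => ?_
    simp only [K, hH, indicator_of_notMem hf, integral_zero]
  have hle : ∀ a ∈ Ioo (0 : ℝ) 1, ∀ b ∈ Ioo (0 : ℝ) 1, a ≤ b →
      M b - M a = ∫ f in a..b, K f := by
    intro a ha b hb hab
    have hsub : Icc a b ⊆ Ioo 0 1 := Icc_subset_Ioo ha.1 hb.2
    have hDi : ∀ f ∈ Ioo (0 : ℝ) 1, Integrable (fun t => D t f) unitVol := fun f hf =>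
      ((hc f hf).integrableOn_Icc (a := 0) (b := 1)).mono_set Ioo_subset_Icc_self
    have hres : volume.restrict (Ioc a b) ≤ unitVol :=
      Measure.restrict_mono (Ioc_subset_Icc_self.trans hsub) le_rfl
    -- For almost every `t` the derivative is integrable in `f`, and an everywhere differentiable
    -- function with integrable derivative satisfies the fundamental theorem without continuity of
    -- the derivative.
    have hftc : ∀ᵐ t ∂unitVol, D t b - D t a = ∫ f in Ioc a b, H t f := by
      filter_upwards [hHi.prod_right_ae] with t ht
      rw [← intervalIntegral.integral_of_le hab]
      refine (intervalIntegral.integral_eq_sub_of_hasDerivAt (fun f hf => ?_) ?_).symm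
      · rw [uIcc_of_le hab] at hf
        simp only [hH, indicator_of_mem (hsub hf)]
        exact ((hd t).differentiableAt (isOpen_Ioo.mem_nhds (hsub hf))).hasDerivAt
      · rw [intervalIntegrable_iff_integrableOn_Ioc_of_le hab]
        exact ht.mono_measure hres
    rw [hint a ha, hint b hb, ← integral_sub (hDi b hb) (hDi a ha), integral_congr_ae hftc,
      intervalIntegral.integral_of_le hab]
    exact integral_integral_swap (hHi.mono_measure (Measure.prod_mono le_rfl hres))
  -- Lebesgue differentiation of the primitive of `K`; the base point `1 / 2` is arbitrary in
  -- `(0,1)`.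
  have heq : ∀ᵐ f ∂unitVol, m f = K f := by
    filter_upwards [ae_restrict_mem measurableSet_Ioo,
      ae_restrict_of_ae (LocallyIntegrable.ae_hasDerivAt_integral hKi.locallyIntegrable)] with f hf hK
    refine (hM f hf).unique ?_
    refine ((hK (1 / 2)).const_add (M (1 / 2))).congr_of_eventuallyEq ?_
    filter_upwards [isOpen_Ioo.mem_nhds hf] with y hy
    have hh : (1 / 2 : ℝ) ∈ Ioo (0 : ℝ) 1 := by norm_num
    rcases le_total (1 / 2) y with h | h
    · rw [← hle _ hh _ hy h]; ring
    · rw [intervalIntegral.integral_symm, ← hle _ hy _ hh h]; ring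
  calc ∫⁻ f, ENNReal.ofReal (m f ^ 2) ∂unitVol
      = ∫⁻ f, ENNReal.ofReal (K f ^ 2) ∂unitVol :=
        lintegral_congr_ae (heq.mono fun f hf => by simp only [hf])
    _ ≤ ∫⁻ f, ∫⁻ t, ENNReal.ofReal (H t f ^ 2) ∂unitVol ∂unitVol :=
        lintegral_mono fun f => ofReal_sq_integral_le
          (hHm.comp measurable_prodMk_right).aestronglyMeasurable
    _ = _ := (lintegral_lintegral_swap hHsq.aemeasurable).symm

/-- Clamping time to `[0,1]` extends the family to all real times; the endpoints are null. -/
theorem lintegral_sq_deriv_le {M m : ℝ → ℝ}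
    (hc : ∀ f ∈ Ioo (0 : ℝ) 1, ContinuousOn (fun t => D t f) (Icc 0 1))
    (hd : ∀ t ∈ Icc (0 : ℝ) 1, DifferentiableOn ℝ (D t) (Ioo 0 1))
    (hM : ∀ f ∈ Ioo (0 : ℝ) 1, HasDerivAt M (m f) f)
    (hint : ∀ f ∈ Ioo (0 : ℝ) 1, M f = ∫ t in (0 : ℝ)..1, D t f) :
    ∫⁻ f, ENNReal.ofReal (m f ^ 2) ∂unitVol ≤ ∫⁻ t in Icc (0 : ℝ) 1, lorenzNormSq (D t) := by
  have hproj : ∀ t ∈ Ioo (0 : ℝ) 1, (projIcc (0 : ℝ) 1 zero_le_one t : ℝ) = t := fun t ht => by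
    rw [projIcc_of_mem _ (Ioo_subset_Icc_self ht)]
  refine (lintegral_sq_deriv_le_of_continuous
    (D := fun t => D (projIcc (0 : ℝ) 1 zero_le_one t)) (fun f hf => ?_)
    (fun t => hd _ (projIcc _ _ _ t).2) hM fun f hf => ?_).trans (le_of_eq ?_)
  · exact (continuousOn_iff_continuous_domRestrict.1 (hc f hf)).comp continuous_projIcc
  · rw [hint f hf, intervalIntegral.integral_of_le zero_le_one, integral_Ioc_eq_integral_Ioo]
    refine setIntegral_congr_fun measurableSet_Ioo fun t ht => ?_
    simp only [hproj t ht]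
  · rw [← Measure.restrict_congr_set (Ioo_ae_eq_Icc (μ := volume) (a := (0 : ℝ)) (b := 1))]
    refine setLIntegral_congr_fun measurableSet_Ioo fun t ht => ?_
    simp only [hproj t ht, lorenzNormSq]
    rw [← Measure.restrict_congr_set (Ioo_ae_eq_Icc (μ := volume) (a := (0 : ℝ)) (b := 1))]

end Action

/-! ### The Lorenz distance in terms of quantile functions -/

namespace IsPosDensity

variable {ρ g : ℝ → ℝ}

lemma hasDerivAt_lorenzCurve (h : IsPosDensity ρ) (hg : IsQuantile g)
    (hm : unitVol.map g = densityMeasure ρ) {f : ℝ} (hf : f ∈ Ioo (0 : ℝ) 1) :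
    HasDerivAt (lorenzCurve ρ) (g f) f := by
  have hgi : IntegrableOn g (Ioc 0 1) := by
    rw [integrableOn_Ioc_iff_integrableOn_Ioo]; exact h.integrable_quantile hg hm
  have hn : Ioo (0 : ℝ) 1 ∈ 𝓝 f := isOpen_Ioo.mem_nhds hf
  have : HasDerivAt (fun x => ∫ y in (0 : ℝ)..x, g y) (g f) f := by
    refine intervalIntegral.integral_hasDerivAt_right ?_
      (hg.continuousOn.stronglyMeasurableAtFilter isOpen_Ioo f hf) (hg.continuousOn.continuousAt hn)
    rw [intervalIntegrable_iff_integrableOn_Ioc_of_le hf.1.le]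
    exact hgi.mono_set (Ioc_subset_Ioc_right hf.2.le)
  refine this.congr_of_eventuallyEq ?_
  filter_upwards [hn] with x hx using h.lorenzCurve_eq hg hm (Ioo_subset_Icc_self hx)

end IsPosDensity

section Distance

variable {k : ℕ∞} {ρ₀ ρ₁ g₀ g₁ : ℝ → ℝ}

theorem lintegral_sq_le_lorenzDistSq (hk : 1 ≤ k) (h₀ : IsPosDensity ρ₀) (h₁ : IsPosDensity ρ₁)
    (hg₀ : IsQuantile g₀) (hg₁ : IsQuantile g₁)
    (hm₀ : unitVol.map g₀ = densityMeasure ρ₀) (hm₁ : unitVol.map g₁ = densityMeasure ρ₁) :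
    ∫⁻ f, ENNReal.ofReal ((g₁ f - g₀ f) ^ 2) ∂unitVol ≤
      lorenzDistSq k (lorenzCurve ρ₀) (lorenzCurve ρ₁) := by
  refine le_iInf₂ fun L hL => ?_
  have hk' : (1 : WithTop ℕ∞) ≤ (k : WithTop ℕ∞) := by exact_mod_cast hk
  -- Here `1 ≤ k` enters: the velocity is continuous in time, so its integral is the total
  -- displacement.
  have hcd : ∀ f ∈ Ioo (0 : ℝ) 1, ContinuousOn (fun t => timeDeriv L t f) (Icc 0 1) := fun f hf =>
    (hL.contDiffOn_time f (Ioo_subset_Icc_self hf)).continuousOn_derivWithin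
      (uniqueDiffOn_Icc zero_lt_one) hk'
  refine lintegral_sq_deriv_le (M := fun f => lorenzCurve ρ₁ f - lorenzCurve ρ₀ f)
    hcd hL.differentiableOn_timeDeriv
    (fun f hf => (h₁.hasDerivAt_lorenzCurve hg₁ hm₁ hf).sub (h₀.hasDerivAt_lorenzCurve hg₀ hm₀ hf))
    fun f hf => ?_
  have hf' := Ioo_subset_Icc_self hf
  have hC := hL.contDiffOn_time f hf'
  rw [← hL.init hf', ← hL.final hf']
  refine (intervalIntegral.integral_eq_sub_of_hasDerivAt_of_le zero_le_one hC.continuousOn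
    (fun t ht => ?_) ?_).symm
  · exact ((hC.differentiableOn (by positivity)) t
      (Ioo_subset_Icc_self ht)).hasDerivWithinAt.hasDerivAt (Icc_mem_nhds ht.1 ht.2)
  · exact (hcd f hf).intervalIntegrable_of_Icc zero_le_one

/-- The segment between the two curves is affine in time, hence smooth, and its velocity has the
constant `f`-derivative in time `g₁ - g₀`. -/
theorem lorenzDistSq_le_lintegral_sq (h₀ : IsPosDensity ρ₀) (h₁ : IsPosDensity ρ₁)
    (hg₀ : IsQuantile g₀) (hg₁ : IsQuantile g₁)
    (hm₀ : unitVol.map g₀ = densityMeasure ρ₀) (hm₁ : unitVol.map g₁ = densityMeasure ρ₁) :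
    lorenzDistSq k (lorenzCurve ρ₀) (lorenzCurve ρ₁) ≤
      ∫⁻ f, ENNReal.ofReal ((g₁ f - g₀ f) ^ 2) ∂unitVol := by
  set L : ℝ → ℝ → ℝ := fun t f => (1 - t) * lorenzCurve ρ₀ f + t * lorenzCurve ρ₁ f
  have hT : ∀ t ∈ Icc (0 : ℝ) 1, timeDeriv L t = fun f => lorenzCurve ρ₁ f - lorenzCurve ρ₀ f := by
    intro t ht
    ext f
    have : HasDerivAt (fun s => L s f) (lorenzCurve ρ₁ f - lorenzCurve ρ₀ f) t := by
      refine HasDerivAt.congr_deriv ((((hasDerivAt_id t).const_sub 1).mul_const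
        (lorenzCurve ρ₀ f)).add ((hasDerivAt_id t).mul_const (lorenzCurve ρ₁ f))) ?_
      ring
    exact this.hasDerivWithinAt.derivWithin (uniqueDiffOn_Icc zero_lt_one t ht)
  have hder : ∀ f ∈ Ioo (0 : ℝ) 1,
      HasDerivAt (fun f => lorenzCurve ρ₁ f - lorenzCurve ρ₀ f) (g₁ f - g₀ f) f := fun f hf =>
    (h₁.hasDerivAt_lorenzCurve hg₁ hm₁ hf).sub (h₀.hasDerivAt_lorenzCurve hg₀ hm₀ hf)
  have hL : IsLorenzPath k (lorenzCurve ρ₀) (lorenzCurve ρ₁) L := by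
    refine ⟨fun t ht => ?_, fun f _ => by simp [L], fun f _ => by simp [L], fun f _ => ?_,
      fun t ht => ?_⟩
    · obtain ⟨ρ, hρ, hm⟩ := exists_isPosDensity_convexComb h₀ h₁ hg₀ hg₁ hm₀ hm₁ ht
      refine ⟨ρ, hρ, fun f hf => ?_⟩
      have hi : ∀ {g : ℝ → ℝ}, Integrable g unitVol → IntervalIntegrable g volume 0 f :=
        fun {g} hg => by
          rw [intervalIntegrable_iff_integrableOn_Ioo_of_le hf.1]
          exact IntegrableOn.mono_set hg (Ioo_subset_Ioo_right hf.2)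
      rw [hρ.lorenzCurve_eq (hg₀.convexComb hg₁ ht) hm hf, intervalIntegral.integral_add
        ((hi (h₀.integrable_quantile hg₀ hm₀)).const_mul _)
        ((hi (h₁.integrable_quantile hg₁ hm₁)).const_mul _),
        intervalIntegral.integral_const_mul, intervalIntegral.integral_const_mul,
        ← h₀.lorenzCurve_eq hg₀ hm₀ hf, ← h₁.lorenzCurve_eq hg₁ hm₁ hf]
    · exact ContDiff.contDiffOn (by fun_prop)
    · rw [hT t ht]
      exact fun f hf => (hder f hf).differentiableAt.differentiableWithinAt
  refine (iInf₂_le L hL).trans (le_of_eq ?_)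
  have : ∀ t ∈ Icc (0 : ℝ) 1, lorenzNormSq (timeDeriv L t) =
      ∫⁻ f, ENNReal.ofReal ((g₁ f - g₀ f) ^ 2) ∂unitVol := by
    intro t ht
    rw [hT t ht, lorenzNormSq,
      ← Measure.restrict_congr_set (Ioo_ae_eq_Icc (μ := volume) (a := (0 : ℝ)) (b := 1))]
    refine setLIntegral_congr_fun measurableSet_Ioo fun f hf => ?_
    simp only [(hder f hf).deriv]
  rw [setLIntegral_congr_fun measurableSet_Icc this]
  simp

end Distance

end

theorem mainTheorem5 (k : ℕ∞) (hk : 1 ≤ k) (ρ₀ ρ₁ : ℝ → ℝ)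
    (h₀ : IsPosDensity ρ₀) (h₁ : IsPosDensity ρ₁) :
    wassersteinSq (densityMeasure ρ₀) (densityMeasure ρ₁) =
      lorenzDistSq k (lorenzCurve ρ₀) (lorenzCurve ρ₁) := by
  obtain ⟨g₀, hg₀, hm₀⟩ := h₀.exists_isQuantile
  obtain ⟨g₁, hg₁, hm₁⟩ := h₁.exists_isQuantile
  rw [wassersteinSq_eq_lintegral hg₀ hg₁ hm₀ hm₁]
  exact le_antisymm (lintegral_sq_le_lorenzDistSq hk h₀ h₁ hg₀ hg₁ hm₀ hm₁)
    (lorenzDistSq_le_lintegral_sq h₀ h₁ hg₀ hg₁ hm₀ hm₁)
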